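/- Let the second-order Eulerian numbers $\left\langle\!\left\langle {n\atop k}\right\rangle\!\right\rangle$ be defined by $\left\langle\!\left\langle {0\atop k}\right\rangle\!\right\rangle=\delta_{0,k}$, by $\left\langle\!\left\langle {n\atop k}\right\rangle\!\right\rangle=0$ for $n\ge 1$, $k\le 0$, and by $\left\langle\!\left\langle {n\atop k}\right\rangle\!\right\rangle=k\left\langle\!\left\langle {n-1\atop k}\right\rangle\!\right\rangle+(2n-k)\left\langle\!\left\langle {n-1\atop k-1}\right\rangle\!\right\rangle$ for $n,k\ge 1$; for $n\ge1$ they vanish unless $1\le k\le n$. A Stirling permutation with finite support set $S$ of nonnegative integers is a word in which each element of $S$ occurs exactly twice, nothing else occurs, and all entries between the two occurrences of $i$ exceed $i$; it has size $n$ and is standard if $S=\{1,\dots,n\}$. A descent of a word is an adjacent pair $a>b$, and in addition a nonempty word has one conventional descent at its end; a plateau is an adjacent pair of equal entries. An increasing ordered tree of size $n$ is a rooted ordered tree with $n+1$ vertices labeled bijectively by $0,1,\dots,n$, each non-root vertex having a larger label than its parent; a leaf is a vertex without children, and a sibling descent is a pair of adjacent siblings of which the first (left) has the larger label. A height-labeled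 Dyck $n$-path is a path of $n$ upsteps $(1,1)$ and $n$ downsteps $(1,-1)$ from $(0,0)$ to $(2n,0)$ that never goes below the $x$-axis, in which each upstep is labeled by a positive integer at most the height of its top vertex; among its $2n+1$ vertices, one is upstep-free if it is not incident with an upstep; a peak is an upstep immediately followed by a downstep. A trapezoidal word of length $n$ is an element of $[1]\times[3]\times\cdots\times[2n-1]$, where $[m]=\{1,\dots,m\}$. Then for every $n\ge 1$, $$\sum_{k=1}^{n}\left\langle\!\left\langle {n\atop k}\right\rangle\!\right\rangle=(2n-1)!!,$$ and for every integer $k\ge 0$ the number $\left\langle\!\left\langle {n\atop k}\right\rangle\!\right\rangle$ counts each of the following: (1) standard Stirling permutations of size $n$ with $k$ descents; (2) standard Stirling permutations of size $n$ with $k$ plateaus; (3) increasing ordered trees of size $n$ with $k$ leaves; (4) height-labeled Dyck $n$-paths with $k$ upstep-free vertices; (5) trapezoidal words of length $n$ with $k$ distinct entries. Furthermore, for every integer $k\ge0$, (6) the number of increasing ordered trees of size $n$ with $k$ sibling descents is $\left\langle\!\left\langle {n\atop n-k}\right\rangle\!\right\rangle$; (7) the number of height-labeled Dyck $n$-paths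 with $k$ peaks is $\left\langle\!\left\langle {n\atop n+1-k}\right\rangle\!\right\rangle$ (a number with a nonpositive lower index being $0$). Moreover, let $\phi$ be the map on Stirling permutations of arbitrary finite support set of nonnegative integers given recursively by $\phi(\emptyset)=\emptyset$ and $\phi(A\,m\,B\,m\,C)=\phi(A)\,m\,\phi(C)\,m\,\phi(B)$, where $m$ is the smallest entry. Then $\phi$ is an involution that preserves the support set (hence the size) and interchanges the number of descents and the number of plateaus. -/

import Mathlib

namespace StirlingObjects

/-- The second-order Eulerian number `⟨⟨n,k⟩⟩`, indexed so that it is non-zero exactly for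
`1 ≤ k ≤ n` when `n ≥ 1`, given by its defining recurrence
`⟨⟨n,k⟩⟩ = k ⟨⟨n-1,k⟩⟩ + (2n-k) ⟨⟨n-1,k-1⟩⟩`. The truncated subtraction `2 * (n + 1) - (k + 1)`
is harmless, since `⟨⟨n,k⟩⟩ = 0` for `k > n`. -/
def eulerianTwo : ℕ → ℕ → ℕ
  | 0, 0 => 1
  | 0, _ + 1 => 0
  | _ + 1, 0 => 0
  | n + 1, k + 1 =>
      (k + 1) * eulerianTwo n (k + 1) + (2 * (n + 1) - (k + 1)) * eulerianTwo n k

/-! ### Stirling permutations -/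

/-- `w` is a Stirling permutation with support set `S`: every element of `S` occurs exactly twice
in `w`, nothing else occurs, and every entry between the two occurrences of `a` exceeds `a`
(`[a, b, a]` is a sublist of `w` iff some entry equal to `b` lies strictly between two
occurrences of `a`). -/
def IsStirlingPerm (S : Finset ℕ) (w : List ℕ) : Prop :=
  (∀ a, w.count a = if a ∈ S then 2 else 0) ∧
    ∀ a b, List.Sublist [a, b, a] w → a < b

/-- Number of descents of a word: adjacent pairs `a > b`, together with a conventional descent at
the end of a nonempty word. -/
def descents : List ℕ → ℕ
  | [] => 0
  | [_] => 1
  | a :: b :: t => (if b < a then 1 else 0) + descents (b :: t)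

/-- Number of plateaus of a word: adjacent pairs of equal entries. -/
def plateaus : List ℕ → ℕ
  | [] => 0
  | [_] => 0
  | a :: b :: t => (if a = b then 1 else 0) + plateaus (b :: t)

/-- The smallest entry of the word `a :: l`. -/
def minEntry (a : ℕ) (l : List ℕ) : ℕ := l.foldr min a

theorem minEntry_mem (a : ℕ) (l : List ℕ) : minEntry a l ∈ a :: l := by
  induction l with
  | nil => simp [minEntry]
  | cons b l ih =>
    have h : minEntry a (b :: l) = min b (minEntry a l) := rfl
    rcases min_choice b (minEntry a l) with h' | h'
    · simp [h, h']
    · rw [h, h']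
      rcases List.mem_cons.1 ih with h2 | h2
      · simp [h2]
      · simp [h2]

/-- The part of `w` before the first occurrence of `m`. -/
def before (m : ℕ) (w : List ℕ) : List ℕ := w.takeWhile (fun x => x != m)

/-- The part of `w` after the first occurrence of `m`. -/
def after (m : ℕ) (w : List ℕ) : List ℕ := (w.dropWhile (fun x => x != m)).tail

theorem length_before_le (m : ℕ) (w : List ℕ) : (before m w).length ≤ w.length :=
  (List.takeWhile_sublist _).length_le

theorem length_after_le (m : ℕ) (w : List ℕ) : (after m w).length ≤ w.length := by
  have h := (List.dropWhile_sublist (l := w) (fun x => x != m)).length_le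
  simp only [after, List.length_tail]
  omega

theorem length_before_add_after {m : ℕ} {w : List ℕ} (h : m ∈ w) :
    (before m w).length + (after m w).length < w.length := by
  induction w with
  | nil => simp at h
  | cons a w ih =>
    by_cases ha : a = m
    · simp [before, after, ha]
    · have hm : m ∈ w := by
        rcases List.mem_cons.1 h with h | h
        · exact absurd h.symm ha
        · exact h
      have := ih hm
      simp only [before, after] at this ⊢
      simp [ha] at this ⊢
      omega

/-- The map `φ` with `φ(∅) = ∅` and `φ(A m B m C) = φ(A) m φ(C) m φ(B)`, where `m` is the smallest
entry of the word `A m B m C`, and `A`, `B` do not contain `m`. -/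
def swapInvolution : List ℕ → List ℕ
  | [] => []
  | a :: l =>
      swapInvolution (before (minEntry a l) (a :: l)) ++
        minEntry a l ::
          (swapInvolution (after (minEntry a l) (after (minEntry a l) (a :: l))) ++
            minEntry a l ::
              swapInvolution (before (minEntry a l) (after (minEntry a l) (a :: l))))
termination_by w => w.length
decreasing_by
  · have := length_before_add_after (minEntry_mem a l)
    omega
  · have := length_before_add_after (minEntry_mem a l)
    have := length_after_le (minEntry a l) (after (minEntry a l) (a :: l))
    omega
  · have := length_before_add_after (minEntry_mem a l)
    have := length_before_le (minEntry a l) (after (minEntry a l) (a :: l))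
    omega

/-! ### Increasing ordered trees -/

/-- Ordered (plane) forests with vertices labeled by natural numbers. A forest is empty, or
`cons a c r`: its first tree has a root labeled `a` whose children are, in order, the roots of the
forest `c`, and this tree is followed by the trees of the forest `r`. -/
inductive LabeledForest : Type
  | nil : LabeledForest
  | cons (label : ℕ) (children : LabeledForest) (rest : LabeledForest) : LabeledForest

namespace LabeledForest

/-- The labels of all vertices, in preorder. -/
def labels : LabeledForest → List ℕ
  | nil => []
  | cons a c r => a :: (c.labels ++ r.labels)

/-- All labels of the roots exceed `p`, and every other vertex has a label larger than that of its
parent. -/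
def IncreasingAbove : ℕ → LabeledForest → Prop
  | _, nil => True
  | p, cons a c r => p < a ∧ IncreasingAbove a c ∧ IncreasingAbove p r

/-- The number of vertices without children. -/
def leaves : LabeledForest → ℕ
  | nil => 0
  | cons _ nil r => 1 + r.leaves
  | cons _ (cons a c r') r => (cons a c r').leaves + r.leaves

/-- The label of the root of the first tree, if there is one. -/
def firstLabel : LabeledForest → Option ℕ
  | nil => none
  | cons a _ _ => some a

/-- The number of pairs of adjacent siblings of which the first has the larger label (the roots of
the forest being regarded as siblings). -/
def siblingDescents : LabeledForest → ℕ
  | nil => 0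
  | cons a c r =>
      (match r.firstLabel with
        | none => 0
        | some b => if b < a then 1 else 0) + c.siblingDescents + r.siblingDescents

end LabeledForest

/-- An ordered tree with vertices labeled by natural numbers: a root with a label, whose children
are, in order, the roots of the forest `branches`. -/
structure LabeledTree : Type where
  rootLabel : ℕ
  branches : LabeledForest

namespace LabeledTree

/-- The labels of all vertices, in preorder. -/
def labels (T : LabeledTree) : List ℕ := T.rootLabel :: T.branches.labels

/-- An increasing ordered tree of size `n`: the `n + 1` vertices carry the labels `0, 1, …, n`,
each once, and each non-root vertex has a larger label than its parent. -/
def IsIncreasingOrdered (n : ℕ) (T : LabeledTree) : Prop :=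
  T.labels.Perm (List.range (n + 1)) ∧ T.branches.IncreasingAbove T.rootLabel

/-- The number of vertices without children. -/
def leaves (T : LabeledTree) : ℕ :=
  match T.branches with
  | .nil => 1
  | .cons a c r => (LabeledForest.cons a c r).leaves

/-- The number of pairs of adjacent siblings of which the first has the larger label. -/
def siblingDescents (T : LabeledTree) : ℕ := T.branches.siblingDescents

end LabeledTree

/-! ### Height-labeled Dyck paths -/

/-- A step of a path: a labeled upstep `(1,1)` or a downstep `(1,-1)`. -/
inductive HLStep : Type
  | up (label : ℕ) : HLStep
  | down : HLStep

/-- The number of upsteps of a path. -/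
def upsteps : List HLStep → ℕ
  | [] => 0
  | .up _ :: p => 1 + upsteps p
  | .down :: p => upsteps p

/-- The path starting at height `h` stays weakly above height `0`, ends at height `0`, and each of
its upsteps is labeled with a positive integer that is at most the height of its top vertex. -/
def IsHeightLabeledFrom : ℕ → List HLStep → Prop
  | h, [] => h = 0
  | h, .up l :: p => 1 ≤ l ∧ l ≤ h + 1 ∧ IsHeightLabeledFrom (h + 1) p
  | 0, .down :: _ => False
  | h + 1, .down :: p => IsHeightLabeledFrom h p

/-- A height-labeled Dyck `n`-path: a height-labeled path from height `0` to height `0` with `n`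
upsteps (and hence `n` downsteps). -/
def IsHLDyckPath (n : ℕ) (p : List HLStep) : Prop :=
  IsHeightLabeledFrom 0 p ∧ upsteps p = n

/-- The number of vertices of a path that are not incident with an upstep, where `prevUp` tells
whether the initial vertex of the path is regarded as preceded by an upstep. -/
def upstepFreeAux : Bool → List HLStep → ℕ
  | prevUp, [] => if prevUp then 0 else 1
  | _, .up _ :: p => upstepFreeAux true p
  | prevUp, .down :: p => (if prevUp then 0 else 1) + upstepFreeAux false p

/-- The number of upstep-free vertices of a path, that is, of vertices (both end vertices
included) that are not incident with an upstep. -/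
def upstepFreeVertices (p : List HLStep) : ℕ := upstepFreeAux false p

/-- The number of peaks of a path: upsteps immediately followed by a downstep. -/
def peaks : List HLStep → ℕ
  | [] => 0
  | .up _ :: .down :: p => 1 + peaks p
  | .up _ :: p => peaks p
  | .down :: p => peaks p

/-! ### Trapezoidal words -/

/-- `w` is a trapezoidal word of length `n`, an element of `[1] × [3] × ⋯ × [2n-1]`. Indices
start at `0`, so that the entry with index `i` lies in `[2i+1]`. -/
def IsTrapezoidal {n : ℕ} (w : Fin n → ℕ) : Prop :=
  ∀ i : Fin n, 1 ≤ w i ∧ w i ≤ 2 * (i : ℕ) + 1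

/-- The number of distinct entries of a word. -/
def distinctEntries {n : ℕ} (w : Fin n → ℕ) : ℕ := (Finset.univ.image w).card

end StirlingObjects

open StirlingObjects

namespace StirlingObjects

/-! Three families satisfy the Eulerian recurrence by the same insertion argument
(`encard_eq_eulerianTwo_succ`): every object of size `n + 1` arises exactly once from an object of
size `n` by one of `2n + 1` insertions. If the statistic is `k`, exactly `k` of the insertions keep
it and the other `2n + 1 - k` raise it by one.

For trapezoidal words one appends an entry of `[2n+1]`, and the statistic is kept when that value
already occurs. For Stirling permutations one inserts the block `(n+1)(n+1)` into a gap, and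
descents are kept at the gaps that are descents, the end included (`descents_insert`). For Dyck
paths one inserts an upstep labeled `1` at a vertex, raises the later labels and adds a last
downstep; the statistic is kept at the upstep-free vertices (`upstepFreeAux_insertUp`).

The rest is transport. The involution carries plateaus to descents, because in `A m B m C` the
letter `m` adds a descent exactly if `C` is empty and a plateau exactly if `B` is empty. The
depth-first word of an increasing tree is a Stirling permutation (`bijOn_word`) whose plateaus are
the leaves. Sibling descents are complementary to the ascents of this word, which are the descents
of its reversal, and peaks are complementary to upstep-free vertices. -/

open Finset in
/-- If `Y` arises from `X` by `2n+1` insertions, of which exactly `s x` preserve the statistic and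
the others increase it by one, then the counts satisfy the second-order Eulerian recurrence. -/
theorem encard_eq_eulerianTwo_succ {α β : Type*} {X : Set α} {Y : Set β} {n : ℕ}
    (ins : α → ℕ → β) (s : α → ℕ) (t : β → ℕ)
    (hbij : Set.BijOn (fun p : α × ℕ => ins p.1 p.2) (X ×ˢ Set.Iio (2 * n + 1)) Y)
    (hval : ∀ x ∈ X, ∀ i < 2 * n + 1, t (ins x i) = s x ∨ t (ins x i) = s x + 1)
    (hcard : ∀ x ∈ X, ∑ i ∈ range (2 * n + 1), (if t (ins x i) = s x then 1 else 0) = s x)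
    (hfin : X.Finite) (hX : ∀ k, {x | x ∈ X ∧ s x = k}.encard = (eulerianTwo n k : ℕ∞)) :
    Y.Finite ∧ ∀ k, {y | y ∈ Y ∧ t y = k}.encard = (eulerianTwo (n + 1) k : ℕ∞) := by
  classical
  have hYfin : Y.Finite := by
    rw [← hbij.image_eq]
    exact (hfin.prod (Set.finite_Iio _)).image _
  refine ⟨hYfin, fun k => ?_⟩
  obtain ⟨F, rfl⟩ := hfin.exists_finset_coe
  have hF : ∀ k, #{x ∈ F | s x = k} = eulerianTwo n k := by
    intro k
    have h := hX k
    have h2 : {x | x ∈ (F : Set α) ∧ s x = k} = (({x ∈ F | s x = k} : Finset α) : Set α) := by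
      ext; simp
    rw [h2, Set.encard_coe_eq_coe_finsetCard] at h
    exact_mod_cast h
  have hset : {y | y ∈ Y ∧ t y = k} = (fun p : α × ℕ => ins p.1 p.2) ''
      (({p ∈ F ×ˢ range (2 * n + 1) | t (ins p.1 p.2) = k} : Finset (α × ℕ)) : Set (α × ℕ)) := by
    ext y
    constructor
    · rintro ⟨hy, rfl⟩
      obtain ⟨p, hp, rfl⟩ := hbij.surjOn hy
      refine ⟨p, ?_, rfl⟩
      simpa using hp
    · rintro ⟨p, hp, rfl⟩
      simp only [coe_filter, mem_product, mem_range, Set.mem_ofPred_eq] at hp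
      exact ⟨hbij.mapsTo (by simpa using hp.1), hp.2⟩
  rw [hset, Set.InjOn.encard_image, Set.encard_coe_eq_coe_finsetCard]
  swap
  · refine hbij.injOn.mono ?_
    intro p hp
    simp only [coe_filter, mem_product, mem_range, Set.mem_ofPred_eq] at hp
    simpa using hp.1
  norm_cast
  rw [card_filter, sum_product]
  -- Only objects with statistic `k` or `k - 1` reach `k`: the former by their `k` neutral
  -- insertions, the latter by all their non-neutral ones.
  have key : ∀ x ∈ F, ∑ i ∈ range (2 * n + 1), (if t (ins x i) = k then 1 else 0)
      = (if s x = k then k else 0) + (if s x + 1 = k then 2 * n + 1 - s x else 0) := by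
    intro x hx
    have hc := hcard x hx
    by_cases h1 : s x = k
    · subst h1; simp [hc]
    by_cases h2 : s x + 1 = k
    · subst h2
      have hsum : ∑ i ∈ range (2 * n + 1), (if t (ins x i) = s x + 1 then 1 else 0)
          + ∑ i ∈ range (2 * n + 1), (if t (ins x i) = s x then 1 else 0)
          = ∑ i ∈ range (2 * n + 1), 1 := by
        rw [← sum_add_distrib]
        refine sum_congr rfl fun i hi => ?_
        rcases hval x hx i (mem_range.1 hi) with h | h <;> simp [h]
      rw [hc] at hsum
      simp only [sum_const, card_range, smul_eq_mul, mul_one] at hsum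
      simp
      simp only [sum_boole, Nat.cast_id] at hsum
      omega
    · rw [if_neg h1, if_neg h2]
      refine sum_eq_zero fun i hi => ?_
      rw [if_neg]
      rcases hval x hx i (mem_range.1 hi) with h | h <;> rw [h] <;> assumption
  rw [sum_congr rfl key, sum_add_distrib]
  have e1 : ∑ x ∈ F, (if s x = k then k else 0) = k * #{x ∈ F | s x = k} := by
    rw [← sum_filter, sum_const, smul_eq_mul, mul_comm]
  rw [e1, hF]
  cases k with
  | zero => simp [eulerianTwo]
  | succ k =>
    have e2 : ∑ x ∈ F, (if s x + 1 = k + 1 then 2 * n + 1 - s x else 0)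
        = (2 * n + 1 - k) * #{x ∈ F | s x = k} := by
      rw [card_filter, mul_sum]
      refine sum_congr rfl fun x _ => ?_
      by_cases h : s x = k <;> simp [h]
    rw [e2, hF, eulerianTwo, show 2 * (n + 1) - (k + 1) = 2 * n + 1 - k by omega]

/-! ### Gap insertions and transport of statistics -/

/-- A word with a chosen gap is the same as a factorization `u ++ v`. This passes from
factorizations, natural for recursion on lists, to the pairs of a word and an index that the
counting needs. -/
theorem bijOn_gapInsertion {α β : Type*} {X : Set (List α)} {Y : Set β} {N : ℕ}
    (f : List α → List α → β) (hlen : ∀ w ∈ X, w.length + 1 = N)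
    (hmaps : ∀ u v, u ++ v ∈ X → f u v ∈ Y)
    (hinj : ∀ u v u' v', u ++ v ∈ X → u' ++ v' ∈ X → f u v = f u' v' → u = u' ∧ v = v')
    (hsurj : ∀ y ∈ Y, ∃ u v, u ++ v ∈ X ∧ f u v = y) :
    Set.BijOn (fun p : List α × ℕ => f (p.1.take p.2) (p.1.drop p.2)) (X ×ˢ Set.Iio N) Y := by
  refine ⟨?_, ?_, ?_⟩
  · rintro ⟨w, i⟩ ⟨hw, -⟩
    exact hmaps _ _ (by simpa using hw)
  · rintro ⟨w, i⟩ ⟨hw, hi⟩ ⟨w', i'⟩ ⟨hw', hi'⟩ h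
    simp only [Set.mem_Iio] at hw hw' hi hi' h
    obtain ⟨h1, h2⟩ := hinj _ _ _ _ (by simpa using hw) (by simpa using hw') h
    have h3 : w = w' := by
      rw [← List.take_append_drop i w, h1, h2, List.take_append_drop]
    have h4 := congrArg List.length h1
    rw [List.length_take, List.length_take] at h4
    have := hlen w hw
    have := hlen w' hw'
    rw [Prod.mk.injEq]
    exact ⟨h3, by omega⟩
  · intro y hy
    obtain ⟨u, v, huv, rfl⟩ := hsurj y hy
    refine ⟨(u ++ v, u.length), ⟨huv, ?_⟩, by simp⟩
    have := hlen _ huv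
    simp only [List.length_append, Set.mem_Iio] at this ⊢
    omega

theorem encard_eq_of_bijOn {α β : Type*} {X : Set α} {Y : Set β} {f : α → β}
    (hf : Set.BijOn f X Y) {s : α → ℕ} {t : β → ℕ} (hst : ∀ x ∈ X, t (f x) = s x) (k : ℕ) :
    {x | x ∈ X ∧ s x = k}.encard = {y | y ∈ Y ∧ t y = k}.encard := by
  have : {y | y ∈ Y ∧ t y = k} = f '' {x | x ∈ X ∧ s x = k} := by
    ext y
    constructor
    · rintro ⟨hy, rfl⟩
      obtain ⟨x, hx, rfl⟩ := hf.surjOn hy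
      exact ⟨x, ⟨hx, (hst x hx).symm⟩, rfl⟩
    · rintro ⟨x, ⟨hx, rfl⟩, rfl⟩
      exact ⟨hf.mapsTo hx, hst x hx⟩
  rw [this, Set.InjOn.encard_image (hf.injOn.mono fun x hx => hx.1)]

/-- If two statistics on `X` add up to `N`, then the counts for one give the counts for the
other. -/
theorem encard_complement_statistic {α : Type*} {X : Set α} {s t : α → ℕ} {N : ℕ} {e : ℕ → ℕ}
    (he : e 0 = 0) (hst : ∀ x ∈ X, s x + t x = N)
    (hs : ∀ k, {x | x ∈ X ∧ s x = k}.encard = (e k : ℕ∞)) (k : ℕ) :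
    {x | x ∈ X ∧ t x = k}.encard = (e (N - k) : ℕ∞) := by
  by_cases hk : k ≤ N
  · rw [← hs]
    congr 1
    ext x
    simp only [Set.mem_ofPred_eq, and_congr_right_iff]
    intro hx
    have := hst x hx
    omega
  -- For `k > N` the truncated difference is `0`, and `e 0 = 0` gives the correct empty count.
  · rw [Nat.sub_eq_zero_of_le (by omega), he]
    simp only [Nat.cast_zero, Set.encard_eq_zero]
    ext x
    simp only [Set.mem_ofPred_eq, Set.mem_empty_iff_false, iff_false, not_and]
    intro hx h
    have := hst x hx
    omega

/-! ### Vanishing and row sums of the second-order Eulerian numbers -/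

theorem eulerianTwo_eq_zero_of_lt {n k : ℕ} (h : n < k) : eulerianTwo n k = 0 := by
  induction n generalizing k with
  | zero => cases k with
    | zero => omega
    | succ k => rfl
  | succ n ih => cases k with
    | zero => rfl
    | succ k => rw [eulerianTwo, ih (by omega), ih (by omega)]; simp

theorem eulerianTwo_zero_right {n : ℕ} (h : 1 ≤ n) : eulerianTwo n 0 = 0 := by
  cases n with
  | zero => omega
  | succ n => rfl

/-- Each `⟨⟨n,k⟩⟩` enters the next row twice, with coefficients `k` and `2n + 1 - k`, which add up
to `2n + 1`. -/
theorem sum_range_eulerianTwo_succ (n : ℕ) :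
    ∑ k ∈ Finset.range (n + 2), eulerianTwo (n + 1) k
      = (2 * n + 1) * ∑ k ∈ Finset.range (n + 1), eulerianTwo n k := by
  rw [Finset.sum_range_succ']
  simp only [eulerianTwo, add_zero]
  rw [Finset.sum_add_distrib]
  have h1 : ∑ k ∈ Finset.range (n + 1), (k + 1) * eulerianTwo n (k + 1)
      = ∑ k ∈ Finset.range (n + 1), k * eulerianTwo n k := by
    have h := Finset.sum_range_succ' (fun k => k * eulerianTwo n k) (n + 1)
    rw [Finset.sum_range_succ, eulerianTwo_eq_zero_of_lt (Nat.lt_succ_self n)] at h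
    simpa using h.symm
  rw [h1, ← Finset.sum_add_distrib, Finset.mul_sum]
  refine Finset.sum_congr rfl fun k hk => ?_
  rw [← add_mul]
  congr 1
  have := Finset.mem_range.1 hk
  omega

theorem sum_eulerianTwo {n : ℕ} (hn : 1 ≤ n) :
    ∑ k ∈ Finset.Icc 1 n, eulerianTwo n k = Nat.doubleFactorial (2 * n - 1) := by
  have h : ∀ n, ∑ k ∈ Finset.range (n + 2), eulerianTwo (n + 1) k
      = Nat.doubleFactorial (2 * n + 1) := by
    intro n
    induction n with
    | zero => decide
    | succ n ih =>
      rw [sum_range_eulerianTwo_succ, ih, show 2 * (n + 1) + 1 = (2 * n + 1) + 2 by ring,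
        Nat.doubleFactorial_add_two]
  obtain ⟨m, rfl⟩ : ∃ m, n = m + 1 := ⟨n - 1, by omega⟩
  rw [show 2 * (m + 1) - 1 = 2 * m + 1 by omega, ← h m, Finset.range_eq_Ico,
    Finset.sum_eq_sum_Ico_succ_bot (by omega), eulerianTwo_zero_right hn, zero_add]
  rfl

/-! ### Trapezoidal words -/

open Finset in
theorem encard_trapezoidal (n : ℕ) :
    {w : Fin n → ℕ | IsTrapezoidal w}.Finite ∧
      ∀ k, {w : Fin n → ℕ | w ∈ {w : Fin n → ℕ | IsTrapezoidal w} ∧ distinctEntries w = k}.encard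
        = (eulerianTwo n k : ℕ∞) := by
  induction n with
  | zero =>
    refine ⟨Set.toFinite _, fun k => ?_⟩
    cases k with
    | zero =>
      rw [Set.encard_eq_one.2 ⟨Fin.elim0, ?_⟩]
      · simp [eulerianTwo]
      · ext w
        simp [IsTrapezoidal, distinctEntries, Subsingleton.elim w Fin.elim0]
    | succ k => simp [eulerianTwo, distinctEntries]
  | succ n ih =>
    have hmem : ∀ w : Fin n → ℕ, ∀ i, distinctEntries (Fin.snoc w (i + 1) : Fin (n + 1) → ℕ)
        = if i + 1 ∈ univ.image w then distinctEntries w else distinctEntries w + 1 := by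
      intro w i
      have : univ.image (Fin.snoc w (i + 1) : Fin (n + 1) → ℕ)
          = insert (i + 1) (univ.image w) := by
        ext x
        simp only [mem_image, mem_univ, true_and, mem_insert, Fin.exists_fin_succ', Fin.snoc_last,
          Fin.snoc_castSucc]
        tauto
      rw [distinctEntries, this, card_insert_eq_ite]
      rfl
    refine encard_eq_eulerianTwo_succ (fun w i => (Fin.snoc w (i + 1) : Fin (n + 1) → ℕ))
      distinctEntries distinctEntries ⟨?_, ?_, ?_⟩ ?_ ?_ ih.1 ih.2
    · rintro ⟨w, i⟩ ⟨hw, hi⟩ j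
      simp only [Set.mem_Iio, Set.mem_ofPred_eq] at hi hw
      refine Fin.lastCases ?_ (fun j => ?_) j
      · simp; omega
      · simpa using hw j
    · rintro ⟨w, i⟩ - ⟨w', i'⟩ - h
      simp only at h
      have h1 := congrFun h (Fin.last n)
      have h2 : w = w' := by
        funext j
        simpa using congrFun h j.castSucc
      simp at h1
      rw [h1, h2]
    · intro w hw
      have hl := hw (Fin.last n)
      simp only [Fin.val_last] at hl
      refine ⟨(fun j => w j.castSucc, w (Fin.last n) - 1), ⟨fun j => ?_, ?_⟩, ?_⟩
      · simpa using hw j.castSucc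
      · simp only [Set.mem_Iio]
        omega
      · funext j
        refine Fin.lastCases ?_ (fun j => ?_) j
        · simp; omega
        · simp
    · intro w _ i _
      rw [hmem]
      split_ifs <;> simp
    · intro w hw
      have : ∀ i, (distinctEntries (Fin.snoc w (i + 1) : Fin (n + 1) → ℕ) = distinctEntries w)
          ↔ i + 1 ∈ univ.image w := by
        intro i
        rw [hmem]
        split_ifs with h <;> simp [h]
      simp only [this, sum_boole, Nat.cast_id]
      -- The neutral choices are the values already present. All of them lie in `[2n+1]`, since
      -- earlier entries obey smaller bounds; the shift by one comes from numbering the choices from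
      -- `0`.
      rw [distinctEntries]
      refine card_nbij (fun i => i + 1) ?_ ?_ ?_
      · intro i hi
        simp only [coe_filter, Set.mem_ofPred_eq] at hi
        exact hi.2
      · intro i _ j _ h
        simpa using h
      · intro x hx
        have hx' := hx
        simp only [coe_image, coe_univ, Set.image_univ, Set.mem_range] at hx'
        obtain ⟨j, rfl⟩ := hx'
        have := hw j
        have hj := j.2
        refine ⟨w j - 1, ?_, by simp; omega⟩
        simp only [coe_filter, mem_range, Set.mem_ofPred_eq]
        rw [Nat.sub_add_cancel this.1]
        exact ⟨by omega, by simp⟩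

/-! ### Height-labeled Dyck paths -/

/-- The step with its label, if any, increased by one. -/
def HLStep.shift : HLStep → HLStep
  | .up l => .up (l + 1)
  | .down => .down

theorem HLStep.shift_injective : Function.Injective HLStep.shift := by
  rintro (l | _) (l' | _) h <;> simp_all [HLStep.shift]

/-- Insertion of an upstep with label `1` between `u` and `v`, together with a last downstep. -/
def insertUp (u v : List HLStep) : List HLStep :=
  u ++ .up 1 :: (v.map HLStep.shift ++ [.down])

theorem IsHeightLabeledFrom.length_eq {h : ℕ} {p : List HLStep} (hp : IsHeightLabeledFrom h p) :
    p.length = h + 2 * upsteps p := by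
  induction p generalizing h with
  | nil => simpa [IsHeightLabeledFrom, upsteps] using hp.symm
  | cons x p ih =>
    rcases x with l | _
    · have := ih hp.2.2
      simp only [List.length_cons, upsteps]
      omega
    · cases h with
      | zero => exact hp.elim
      | succ h =>
        have := ih (h := h) hp
        simp only [List.length_cons, upsteps]
        omega

theorem IsHeightLabeledFrom.one_le {h l : ℕ} {p : List HLStep} (hp : IsHeightLabeledFrom h p)
    (hl : HLStep.up l ∈ p) : 1 ≤ l := by
  induction p generalizing h with
  | nil => simp at hl
  | cons x p ih =>
    rcases x with l' | _
    · rcases List.mem_cons.1 hl with h1 | h1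
      · cases h1
        exact hp.1
      · exact ih hp.2.2 h1
    · cases h with
      | zero => exact hp.elim
      | succ h => exact ih (h := h) hp (by simpa using hl)

theorem IsHeightLabeledFrom.map_shift {h : ℕ} {p : List HLStep} (hp : IsHeightLabeledFrom h p) :
    IsHeightLabeledFrom (h + 1) (p.map HLStep.shift ++ [.down]) := by
  induction p generalizing h with
  | nil => simpa [IsHeightLabeledFrom] using hp
  | cons x p ih =>
    rcases x with l | _
    · obtain ⟨h1, h2, h3⟩ := hp
      exact ⟨by omega, by omega, ih h3⟩
    · cases h with
      | zero => exact hp.elim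
      | succ h => exact ih (h := h) hp

theorem IsHeightLabeledFrom.insertUp {h : ℕ} {u v : List HLStep}
    (hp : IsHeightLabeledFrom h (u ++ v)) : IsHeightLabeledFrom h (insertUp u v) := by
  induction u generalizing h with
  | nil => exact ⟨le_rfl, by omega, hp.map_shift⟩
  | cons x u ih =>
    rcases x with l | _
    · exact ⟨hp.1, hp.2.1, ih hp.2.2⟩
    · cases h with
      | zero => exact hp.elim
      | succ h => exact ih (h := h) hp

/-- The inserted step is recovered as the last upstep labeled `1`. A nonempty tail without such a
step meets the axis only at its end, because an upstep from the axis must be labeled `1`; hence the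
tail is a lifted path followed by a downstep, which is the second alternative. -/
theorem IsHeightLabeledFrom.exists_insertUp {h : ℕ} {q : List HLStep}
    (hq : IsHeightLabeledFrom h q) :
    (∃ u v, IsHeightLabeledFrom h (u ++ v) ∧ StirlingObjects.insertUp u v = q) ∨
      (∃ h' p, h = h' + 1 ∧ IsHeightLabeledFrom h' p ∧ q = p.map HLStep.shift ++ [.down]) ∨
      (h = 0 ∧ q = []) := by
  induction q generalizing h with
  | nil => exact .inr (.inr ⟨hq, rfl⟩)
  | cons x q ih =>
    rcases x with l | _
    · obtain ⟨h1, h2, h3⟩ := hq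
      rcases ih h3 with ⟨u, v, huv, rfl⟩ | ⟨h', p, hh, hp, rfl⟩ | ⟨hh, -⟩
      · exact .inl ⟨.up l :: u, v, ⟨h1, h2, huv⟩, rfl⟩
      · obtain rfl : h = h' := by omega
        obtain rfl | ⟨l, rfl⟩ : l = 1 ∨ ∃ m, l = m + 1 + 1 := by
          rcases l with _ | _ | l
          · omega
          · exact .inl rfl
          · exact .inr ⟨l, rfl⟩
        · exact .inl ⟨[], p, hp, rfl⟩
        -- A label of at least `2` cannot sit on an upstep from height `0`.
        · cases h with
          | zero => omega
          | succ h => exact .inr (.inl ⟨h, .up (l + 1) :: p, rfl, ⟨by omega, by omega, hp⟩, rfl⟩)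
      · omega
    · cases h with
      | zero => exact hq.elim
      | succ h =>
        rcases ih (h := h) hq with ⟨u, v, huv, rfl⟩ | ⟨h', p, rfl, hp, rfl⟩ | ⟨rfl, rfl⟩
        · exact .inl ⟨.down :: u, v, huv, rfl⟩
        · exact .inr (.inl ⟨h' + 1, .down :: p, rfl, hp, rfl⟩)
        · exact .inr (.inl ⟨0, [], rfl, rfl, rfl⟩)

theorem append_cons_inj_of_notMem_right {α : Type*} {c : α} {u v u' v' : List α} (hv : c ∉ v)
    (hv' : c ∉ v') (h : u ++ c :: v = u' ++ c :: v') : u = u' ∧ v = v' := by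
  induction u generalizing u' with
  | nil =>
    cases u' with
    | nil => simpa using h
    | cons x u' =>
      simp only [List.nil_append, List.cons_append, List.cons.injEq] at h
      exact absurd (h.2 ▸ by simp) hv
  | cons x u ih =>
    cases u' with
    | nil =>
      simp only [List.nil_append, List.cons_append, List.cons.injEq] at h
      exact absurd (h.2 ▸ by simp) hv'
    | cons x' u' =>
      simp only [List.cons_append, List.cons.injEq] at h
      obtain ⟨h1, h2⟩ := ih h.2
      exact ⟨by rw [h.1, h1], h2⟩

/-- Shifted labels are at least `2`, so the inserted step is the last upstep labeled `1` and its
position is determined. -/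
theorem insertUp_inj {u v u' v' : List HLStep} (hv : ∀ l, HLStep.up l ∈ v → 1 ≤ l)
    (hv' : ∀ l, HLStep.up l ∈ v' → 1 ≤ l) (h : insertUp u v = insertUp u' v') :
    u = u' ∧ v = v' := by
  have key : ∀ v : List HLStep, (∀ l, HLStep.up l ∈ v → 1 ≤ l) →
      HLStep.up 1 ∉ v.map HLStep.shift ++ [.down] := by
    intro v hv hm
    simp only [List.mem_append, List.mem_map, List.mem_cons, reduceCtorEq, List.not_mem_nil,
      or_false] at hm
    obtain ⟨x, hx, hx'⟩ := hm
    rcases x with l | _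
    · have := hv l hx
      simp only [HLStep.shift, HLStep.up.injEq] at hx'
      omega
    · simp [HLStep.shift] at hx'
  obtain ⟨h1, h2⟩ := append_cons_inj_of_notMem_right (key v hv) (key v' hv') h
  exact ⟨h1, List.map_injective_iff.2 HLStep.shift_injective (List.append_cancel_right h2)⟩

theorem upsteps_append (p q : List HLStep) : upsteps (p ++ q) = upsteps p + upsteps q := by
  induction p with
  | nil => simp [upsteps]
  | cons x p ih => rcases x with l | _ <;> simp [upsteps, ih, add_assoc]

theorem upsteps_map_shift (p : List HLStep) : upsteps (p.map HLStep.shift) = upsteps p := by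
  induction p with
  | nil => rfl
  | cons x p ih => rcases x with l | _ <;> simp [upsteps, ih, HLStep.shift]

theorem upsteps_insertUp (u v : List HLStep) :
    upsteps (insertUp u v) = upsteps (u ++ v) + 1 := by
  simp only [insertUp, upsteps_append, upsteps, upsteps_map_shift]
  ring

theorem upstepFreeAux_map_shift (b : Bool) (p : List HLStep) :
    upstepFreeAux b (p.map HLStep.shift ++ [.down]) = upstepFreeAux b p + 1 := by
  induction p generalizing b with
  | nil => cases b <;> rfl
  | cons x p ih => rcases x with l | _ <;> simp [upstepFreeAux, ih, HLStep.shift, add_assoc]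

/-- The new final downstep adds one upstep-free vertex. The vertex of insertion splits into the two
ends of the new upstep, so one upstep-free vertex is lost exactly if that vertex was upstep-free. -/
theorem upstepFreeAux_insertUp (b : Bool) (p : List HLStep) :
    (∀ i, upstepFreeAux b (insertUp (p.take i) (p.drop i)) = upstepFreeAux b p ∨
        upstepFreeAux b (insertUp (p.take i) (p.drop i)) = upstepFreeAux b p + 1) ∧
      ∑ i ∈ Finset.range (p.length + 1),
        (if upstepFreeAux b (insertUp (p.take i) (p.drop i)) = upstepFreeAux b p then 1 else 0)
          = upstepFreeAux b p := by
  induction p generalizing b with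
  | nil => cases b <;> simp [insertUp, upstepFreeAux]
  | cons x p ih =>
    rcases x with l | _
    · obtain ⟨h1, h2⟩ := ih true
      constructor
      · rintro (_ | i)
        · simp [insertUp, upstepFreeAux, HLStep.shift, upstepFreeAux_map_shift]
        · exact h1 i
      · rw [List.length_cons, Finset.sum_range_succ']
        refine (congrArg₂ (· + ·) h2 ?_).trans (add_zero _)
        simp [insertUp, upstepFreeAux, HLStep.shift, upstepFreeAux_map_shift]
    · obtain ⟨h1, h2⟩ := ih false
      have h0 : upstepFreeAux b (insertUp [] (.down :: p)) = upstepFreeAux false p + 1 := by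
        simp [insertUp, upstepFreeAux, HLStep.shift, upstepFreeAux_map_shift]
      have hs : ∀ q, upstepFreeAux b (.down :: q)
          = (if b then 0 else 1) + upstepFreeAux false q := fun q => rfl
      constructor
      · rintro (_ | i)
        · simp only [List.take_zero, List.drop_zero]
          rw [h0, hs]
          cases b <;> simp [add_comm]
        · have := h1 i
          change upstepFreeAux b (.down :: insertUp (p.take i) (p.drop i)) = _ ∨
            upstepFreeAux b (.down :: insertUp (p.take i) (p.drop i)) = _
          rw [hs, hs]
          omega
      · rw [List.length_cons, Finset.sum_range_succ']
        have : ∀ i, upstepFreeAux b (insertUp (List.take (i + 1) (.down :: p))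
            (List.drop (i + 1) (.down :: p))) = (if b then 0 else 1) +
              upstepFreeAux false (insertUp (p.take i) (p.drop i)) := fun i => rfl
        simp only [this, List.take_zero, List.drop_zero, h0, hs, add_right_inj, h2]
        cases b <;> simp [add_comm]

theorem bijOn_insertUp (n : ℕ) :
    Set.BijOn (fun p : List HLStep × ℕ => insertUp (p.1.take p.2) (p.1.drop p.2))
      ({p | IsHLDyckPath n p} ×ˢ Set.Iio (2 * n + 1)) {p | IsHLDyckPath (n + 1) p} := by
  refine bijOn_gapInsertion insertUp ?_ ?_ ?_ ?_
  · rintro p ⟨hp, rfl⟩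
    have := hp.length_eq
    omega
  · rintro u v ⟨h, hn⟩
    exact ⟨h.insertUp, by rw [upsteps_insertUp, hn]⟩
  · rintro u v u' v' ⟨h, -⟩ ⟨h', -⟩ he
    exact insertUp_inj (fun l hl => h.one_le (by simp [hl])) (fun l hl => h'.one_le (by simp [hl]))
      he
  · rintro q ⟨hq, hn⟩
    rcases hq.exists_insertUp with ⟨u, v, huv, rfl⟩ | ⟨h', p, hh, -⟩ | ⟨-, rfl⟩
    · refine ⟨u, v, ⟨huv, ?_⟩, rfl⟩
      rw [upsteps_insertUp] at hn
      omega
    · omega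
    · simp [upsteps] at hn

/-- The flag `true` disregards the initial vertex. This matters only for the empty path, whose
single vertex would otherwise count although `⟨⟨0,0⟩⟩ = 1` requires the value `0`. -/
theorem encard_hlDyckPath_upstepFreeAux (n : ℕ) :
    {p | IsHLDyckPath n p}.Finite ∧
      ∀ k, {p | p ∈ {p | IsHLDyckPath n p} ∧ upstepFreeAux true p = k}.encard
        = (eulerianTwo n k : ℕ∞) := by
  induction n with
  | zero =>
    have h0 : {p | IsHLDyckPath 0 p} = {[]} := by
      ext p
      simp only [Set.mem_ofPred_eq, Set.mem_singleton_iff]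
      constructor
      · rintro ⟨hp, hn⟩
        have := hp.length_eq
        rw [hn] at this
        exact List.length_eq_zero_iff.1 this
      · rintro rfl
        exact ⟨rfl, rfl⟩
    rw [h0]
    refine ⟨Set.finite_singleton _, fun k => ?_⟩
    cases k with
    | zero =>
      rw [Set.encard_eq_one.2 ⟨[], ?_⟩]
      · simp [eulerianTwo]
      · ext p
        simp only [Set.mem_singleton_iff, Set.mem_ofPred_eq, and_iff_left_iff_imp]
        rintro rfl
        rfl
    | succ k =>
      simp only [eulerianTwo, Nat.cast_zero, Set.encard_eq_zero]
      ext p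
      simp only [Set.mem_singleton_iff, Set.mem_ofPred_eq, Set.mem_empty_iff_false, iff_false,
        not_and]
      rintro rfl
      simp [upstepFreeAux]
  | succ n ih =>
    have hlen : ∀ p ∈ {p | IsHLDyckPath n p}, 2 * n + 1 = p.length + 1 := by
      rintro p ⟨hp, rfl⟩
      rw [hp.length_eq, zero_add]
    refine encard_eq_eulerianTwo_succ (fun p i => insertUp (p.take i) (p.drop i)) _ _
      (bijOn_insertUp n) ?_ ?_ ih.1 ih.2
    · intro p _ i _
      exact (upstepFreeAux_insertUp true p).1 i
    · intro p hp
      rw [hlen p hp]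
      exact (upstepFreeAux_insertUp true p).2

theorem encard_hlDyckPath {n : ℕ} (hn : 1 ≤ n) (k : ℕ) :
    {p | IsHLDyckPath n p ∧ upstepFreeVertices p = k}.encard = (eulerianTwo n k : ℕ∞) := by
  rw [← (encard_hlDyckPath_upstepFreeAux n).2 k]
  congr 1
  ext p
  simp only [Set.mem_ofPred_eq, and_congr_right_iff]
  rintro ⟨hp, hu⟩
  rcases p with _ | ⟨l | _, p⟩
  · simp only [upsteps] at hu
    omega
  · rfl
  · exact hp.elim

/-- A downstep starts either at a peak or at an upstep-free vertex, and the final vertex is one more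
upstep-free vertex, so the sum is the number of downsteps plus one. The second clause carries the
induction across a preceding upstep. -/
theorem peaks_add_upstepFreeAux {h : ℕ} {p : List HLStep} (hp : IsHeightLabeledFrom h p) :
    peaks p + upstepFreeAux false p = h + upsteps p + 1 ∧
      (p ≠ [] → ∀ l, peaks (.up l :: p) + upstepFreeAux true p = h + upsteps p + 1) := by
  induction p generalizing h with
  | nil =>
    have : h = 0 := hp
    simp [peaks, upstepFreeAux, upsteps, this]
  | cons x p ih =>
    rcases x with l | _
    · have hne : p ≠ [] := by
        rintro rfl
        exact absurd hp.2.2 (Nat.succ_ne_zero h)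
      have := (ih hp.2.2).2 hne l
      simp only [peaks, upstepFreeAux, upsteps]
      exact ⟨by omega, fun _ _ => by omega⟩
    · cases h with
      | zero => exact hp.elim
      | succ h =>
        have := (ih (h := h) hp).1
        simp only [peaks, upstepFreeAux, upsteps, Bool.false_eq_true, if_true, if_false]
        exact ⟨by omega, fun _ _ => by omega⟩

/-! ### Stirling permutations -/

/-- A Stirling permutation of some support set. -/
def IsStirlingWord (w : List ℕ) : Prop :=
  (∀ a ∈ w, w.count a = 2) ∧ ∀ a b, List.Sublist [a, b, a] w → a < b

theorem isStirlingPerm_iff {S : Finset ℕ} {w : List ℕ} :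
    IsStirlingPerm S w ↔ IsStirlingWord w ∧ ∀ a, a ∈ w ↔ a ∈ S := by
  constructor
  · rintro ⟨h1, h2⟩
    have hm : ∀ a, a ∈ w ↔ a ∈ S := by
      intro a
      rw [← List.count_pos_iff, h1]
      split_ifs with h <;> simp [h]
    exact ⟨⟨fun a ha => by rw [h1, if_pos ((hm a).1 ha)], h2⟩, hm⟩
  · rintro ⟨⟨h1, h2⟩, hm⟩
    refine ⟨fun a => ?_, h2⟩
    split_ifs with h
    · exact h1 a ((hm a).2 h)
    · exact List.count_eq_zero.2 fun ha => h ((hm a).1 ha)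

theorem IsStirlingPerm.length_eq {S : Finset ℕ} {w : List ℕ} (h : IsStirlingPerm S w) :
    w.length = 2 * S.card := by
  have hm := (isStirlingPerm_iff.1 h).2
  have hS : (w : Multiset ℕ).toFinset = S := by
    ext a
    simp [hm]
  have := Multiset.toFinset_sum_count_eq (w : Multiset ℕ)
  rw [hS, Finset.sum_congr rfl (g := fun _ => 2)] at this
  · simp at this
    omega
  · intro a ha
    simp [h.1 a, ha]

theorem isStirlingWord_nil : IsStirlingWord [] := by
  constructor <;> simp

theorem sublist_aba_append {a b : ℕ} {X Y : List ℕ} (h : [a, b, a].Sublist (X ++ Y))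
    (hd : a ∈ X → a ∉ Y) : [a, b, a].Sublist X ∨ [a, b, a].Sublist Y := by
  obtain ⟨l₁, l₂, hl, h1, h2⟩ := List.sublist_append_iff.1 h
  rcases l₁ with _ | ⟨x, _ | ⟨y, _ | ⟨z, l₁⟩⟩⟩
  · exact .inr (by simpa [hl] using h2)
  · simp only [List.cons_append, List.nil_append, List.cons.injEq] at hl
    obtain ⟨rfl, rfl⟩ := hl
    exact absurd (h2.subset (by simp)) (hd (h1.subset (by simp)))
  · simp only [List.cons_append, List.nil_append, List.cons.injEq] at hl
    obtain ⟨rfl, rfl, rfl⟩ := hl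
    exact absurd (h2.subset (by simp)) (hd (h1.subset (by simp)))
  · simp only [List.cons_append, List.cons.injEq] at hl
    obtain ⟨rfl, rfl, rfl, hl⟩ := hl
    obtain ⟨rfl, rfl⟩ := List.append_eq_nil_iff.1 hl.symm
    exact .inl h1

theorem isStirlingWord_append {X Y : List ℕ} (hd : ∀ x ∈ X, x ∉ Y) :
    IsStirlingWord (X ++ Y) ↔ IsStirlingWord X ∧ IsStirlingWord Y := by
  have hX : ∀ a ∈ X, (X ++ Y).count a = X.count a := by
    intro a ha
    rw [List.count_append, List.count_eq_zero.2 (hd a ha), add_zero]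
  have hY : ∀ a ∈ Y, (X ++ Y).count a = Y.count a := by
    intro a ha
    rw [List.count_append, List.count_eq_zero.2 fun h => hd a h ha, zero_add]
  constructor
  · rintro ⟨h1, h2⟩
    refine ⟨⟨fun a ha => ?_, fun a b h => ?_⟩, ⟨fun a ha => ?_, fun a b h => ?_⟩⟩
    · rw [← hX a ha, h1 a (by simp [ha])]
    · exact h2 a b (h.trans (List.sublist_append_left _ _))
    · rw [← hY a ha, h1 a (by simp [ha])]
    · exact h2 a b (h.trans (List.sublist_append_right _ _))
  · rintro ⟨⟨h1, h2⟩, ⟨h3, h4⟩⟩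
    refine ⟨fun a ha => ?_, fun a b h => ?_⟩
    · rcases List.mem_append.1 ha with ha | ha
      · rw [hX a ha, h1 a ha]
      · rw [hY a ha, h3 a ha]
    · rcases sublist_aba_append h (hd a) with h | h
      · exact h2 a b h
      · exact h4 a b h

theorem isStirlingWord_wrap {m : ℕ} {B : List ℕ} (hB : ∀ x ∈ B, m < x) :
    IsStirlingWord (m :: (B ++ [m])) ↔ IsStirlingWord B := by
  have hm : m ∉ B := fun h => lt_irrefl _ (hB m h)
  have hc : ∀ a, a ≠ m → (m :: (B ++ [m])).count a = B.count a := by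
    intro a ha
    simp [List.count_append, ha.symm]
  constructor
  · rintro ⟨h1, h2⟩
    refine ⟨fun a ha => ?_, fun a b h => ?_⟩
    · rw [← hc a (ne_of_mem_of_not_mem ha hm), h1 a (by simp [ha])]
    · exact h2 a b ((h.trans (List.sublist_append_left _ _)).cons _)
  · rintro ⟨h1, h2⟩
    refine ⟨fun a ha => ?_, fun a b h => ?_⟩
    · by_cases hma : a = m
      · subst hma
        simp [List.count_append, List.count_eq_zero.2 hm]
      · rw [hc a hma]
        exact h1 a (by simpa [hma] using ha)
    · by_cases hma : a = m
      · subst hma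
        have h3 : [b, a].Sublist (B ++ [a]) := by simpa using h
        have h4 : [b].Sublist B := by
          -- Reversal brings the closing letter to the front, where it can be cancelled.
          have := List.Sublist.reverse h3
          simp only [List.reverse_append, List.reverse_cons, List.reverse_nil, List.nil_append,
            List.cons_append, List.cons_sublist_cons] at this
          simpa using this
        exact hB b (h4.subset (by simp))
      · have h3 : [a, b, a].Sublist ([m] ++ (B ++ [m])) := h
        rcases sublist_aba_append h3 (fun h => absurd (by simpa using h) hma) with h4 | h4
        · simpa using h4.length_le
        · rcases sublist_aba_append h4 (fun _ h => absurd (by simpa using h) hma) with h4 | h4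
          · exact h2 a b h4
          · simpa using h4.length_le

/-- Only `B` has to exceed `m`. Thus the lemma serves both the splitting at the smallest entry and,
with `A` empty, the splitting at the first letter used for trees. -/
theorem isStirlingWord_node {m : ℕ} {A B C : List ℕ} (hA : m ∉ A) (hC : m ∉ C)
    (hB : ∀ x ∈ B, m < x) (hAB : ∀ x ∈ A, x ∉ B) (hAC : ∀ x ∈ A, x ∉ C) (hBC : ∀ x ∈ B, x ∉ C) :
    IsStirlingWord (A ++ m :: (B ++ m :: C)) ↔
      IsStirlingWord A ∧ IsStirlingWord B ∧ IsStirlingWord C := by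
  have : A ++ m :: (B ++ m :: C) = A ++ (m :: (B ++ [m]) ++ C) := by simp
  rw [this, isStirlingWord_append, isStirlingWord_append, isStirlingWord_wrap hB]
  · intro x hx
    simp only [List.mem_cons, List.mem_append, List.not_mem_nil, or_false] at hx
    rcases hx with rfl | hx | rfl
    exacts [hC, hBC x hx, hC]
  · intro x hx h
    simp only [List.mem_cons, List.mem_append, List.not_mem_nil, or_false] at h
    rcases h with (rfl | h | rfl) | h
    exacts [hA hx, hAB x hx h, hA hx, hAC x hx h]

/-- A letter in both `A` and `C` encloses `m`, hence is smaller. So `A` and `C` are disjoint at the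
smallest letter, while at the largest letter `B` is empty. -/
theorem IsStirlingWord.exists_split {w : List ℕ} {m : ℕ} (hw : IsStirlingWord w) (hm : m ∈ w) :
    ∃ A B C, w = A ++ m :: (B ++ m :: C) ∧ m ∉ A ∧ m ∉ B ∧ m ∉ C ∧ (∀ x ∈ B, m < x) ∧
      (∀ x ∈ A, x ∉ B) ∧ (∀ x ∈ B, x ∉ C) ∧ (∀ x ∈ A, x ∈ C → x < m) := by
  obtain ⟨A, D, rfl, hA⟩ := List.eq_append_cons_of_mem hm
  have hc := hw.1 m hm
  rw [List.count_append, List.count_eq_zero.2 hA, List.count_cons_self] at hc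
  obtain ⟨B, C, rfl, hB⟩ :=
    List.eq_append_cons_of_mem (List.count_pos_iff.1 (by omega : 0 < D.count m))
  rw [List.count_append, List.count_eq_zero.2 hB, List.count_cons_self] at hc
  have hC : m ∉ C := List.count_eq_zero.1 (by omega)
  have sub : ∀ {x : ℕ} {X : List ℕ}, x ∈ X → [x].Sublist X := fun h => List.singleton_sublist.2 h
  have hmB : ∀ x ∈ B, m < x := by
    intro x hx
    refine hw.2 m x ?_
    exact List.Sublist.trans
      (List.Sublist.cons_cons m ((sub hx).append (sub (by simp : m ∈ m :: C))))
      (List.sublist_append_right A _)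
  refine ⟨A, B, C, rfl, hA, hB, hC, hmB, ?_, ?_, ?_⟩
  · intro x hx hx'
    have : x < m := hw.2 x m ((sub hx).append (List.Sublist.cons_cons m
      ((sub hx').trans (List.sublist_append_left _ _))))
    exact absurd (hmB x hx') this.asymm
  · intro x hx hx'
    have : x < m := hw.2 x m (List.Sublist.trans
      (((sub hx).append (List.Sublist.cons_cons m (sub hx'))).cons m)
      (List.sublist_append_right A _))
    exact absurd (hmB x hx) this.asymm
  · intro x hx hx'
    exact hw.2 x m ((sub hx).append (List.Sublist.cons_cons m
      ((sub hx').trans ((List.sublist_cons_self _ _).trans (List.sublist_append_right _ _)))))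

theorem minEntry_le {a : ℕ} {l : List ℕ} (x : ℕ) (hx : x ∈ a :: l) : minEntry a l ≤ x := by
  induction l with
  | nil => simp_all [minEntry]
  | cons b l ih =>
    have h : minEntry a (b :: l) = min b (minEntry a l) := rfl
    rw [h]
    simp only [List.mem_cons] at hx ih
    rcases hx with rfl | rfl | hx
    · exact (min_le_right _ _).trans (ih (.inl rfl))
    · exact min_le_left _ _
    · exact (min_le_right _ _).trans (ih (.inr hx))

/-- Induction on Stirling words along the decomposition at the smallest entry. -/
theorem IsStirlingWord.induction {P : List ℕ → Prop} (hnil : P [])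
    (hnode : ∀ m A B C, (∀ x ∈ A, m < x) → (∀ x ∈ B, m < x) → (∀ x ∈ C, m < x) →
      (∀ x ∈ A, x ∉ B) → (∀ x ∈ A, x ∉ C) → (∀ x ∈ B, x ∉ C) →
      P A → P B → P C → P (A ++ m :: (B ++ m :: C)))
    {w : List ℕ} (hw : IsStirlingWord w) : P w := by
  induction hn : w.length using Nat.strong_induction_on generalizing w with
  | _ n ih =>
    subst hn
    rcases w with _ | ⟨a, l⟩
    · exact hnil
    have hle : ∀ x ∈ a :: l, minEntry a l ≤ x := fun x hx => minEntry_le x hx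
    obtain ⟨A, B, C, h, hA, hB, hC, hmB, hAB, hBC, hAC⟩ := hw.exists_split (minEntry_mem a l)
    have hmA : ∀ x ∈ A, minEntry a l < x := fun x hx =>
      lt_of_le_of_ne (hle x (by simp [h, hx])) (ne_of_mem_of_not_mem hx hA).symm
    have hmC : ∀ x ∈ C, minEntry a l < x := fun x hx =>
      lt_of_le_of_ne (hle x (by simp [h, hx])) (ne_of_mem_of_not_mem hx hC).symm
    have hAC' : ∀ x ∈ A, x ∉ C := fun x hx hx' => absurd (hAC x hx hx') (hmA x hx).asymm
    generalize minEntry a l = m at *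
    rw [h] at hw ih ⊢
    rw [isStirlingWord_node hA hC hmB hAB hAC' hBC] at hw
    simp only [List.length_append, List.length_cons] at ih
    exact hnode m A B C hmA hmB hmC hAB hAC' hBC (ih _ (by omega) hw.1 rfl)
      (ih _ (by omega) hw.2.1 rfl) (ih _ (by omega) hw.2.2 rfl)

theorem IsStirlingPerm.reverse {S : Finset ℕ} {w : List ℕ} (h : IsStirlingPerm S w) :
    IsStirlingPerm S w.reverse := by
  refine ⟨fun a => by rw [List.count_reverse, h.1], fun a b hab => h.2 a b ?_⟩
  simpa using hab.reverse

/-! ### Descents and plateaus -/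

/-- The conventional descent at the end of a nonempty `A` becomes the genuine descent to `m`. -/
theorem descents_append_cons {m : ℕ} {A : List ℕ} (hA : ∀ x ∈ A, m < x) (X : List ℕ) :
    descents (A ++ m :: X) = descents A + descents (m :: X) := by
  induction A with
  | nil => simp [descents]
  | cons a A ih =>
    cases A with
    | nil => simp [descents, hA a (by simp)]
    | cons b A =>
      have := ih fun x hx => hA x (by simp [hx])
      simp only [List.cons_append, descents] at this ⊢
      omega

theorem descents_cons_of_lt {m : ℕ} {X : List ℕ} (hX : ∀ x ∈ X, m < x) :
    descents (m :: X) = descents X + if X = [] then 1 else 0 := by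
  cases X with
  | nil => simp [descents]
  | cons a X => simp [descents, (hX a (by simp)).le]

theorem descents_wrap {m : ℕ} {B : List ℕ} (hB : ∀ x ∈ B, m < x) (C : List ℕ) :
    descents (m :: (B ++ m :: C)) = descents B + descents (m :: C) := by
  cases B with
  | nil => simp [descents]
  | cons b B =>
    rw [← descents_append_cons hB]
    simp [descents, (hB b (by simp)).le]

theorem plateaus_append_cons {m : ℕ} {A : List ℕ} (hA : m ∉ A) (X : List ℕ) :
    plateaus (A ++ m :: X) = plateaus A + plateaus (m :: X) := by
  induction A with
  | nil => simp [plateaus]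
  | cons a A ih =>
    cases A with
    | nil =>
      have : a ≠ m := by rintro rfl; simp at hA
      simp [plateaus, this]
    | cons b A =>
      have := ih fun hx => hA (by simp [hx])
      simp only [List.cons_append, plateaus] at this ⊢
      omega

theorem plateaus_cons_of_notMem {m : ℕ} {X : List ℕ} (hX : m ∉ X) :
    plateaus (m :: X) = plateaus X := by
  cases X with
  | nil => simp [plateaus]
  | cons a X =>
    have : m ≠ a := by rintro rfl; simp at hX
    simp [plateaus, this]

theorem plateaus_wrap {m : ℕ} {B C : List ℕ} (hB : m ∉ B) (hC : m ∉ C) :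
    plateaus (m :: (B ++ m :: C)) = plateaus B + plateaus C + if B = [] then 1 else 0 := by
  rw [← plateaus_cons_of_notMem hC]
  cases B with
  | nil => simp [plateaus, add_comm]
  | cons b B =>
    rw [← plateaus_append_cons hB]
    have : m ≠ b := by rintro rfl; simp at hB
    simp [plateaus, this]

theorem descents_append_pair (u : List ℕ) (b a : ℕ) :
    descents (u ++ [b, a]) = descents (u ++ [b]) + if a < b then 1 else 0 := by
  induction u with
  | nil => simp [descents, add_comm]
  | cons c u ih =>
    cases u with
    | nil => simp [descents]; omega
    | cons d u =>
      simp only [List.cons_append, descents] at ih ⊢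
      omega

/-- Descents, plateaus and ascents (with a conventional ascent at the start, and counted as descents
of the reversed word) add up to the number of gaps. -/
theorem descents_add_plateaus_add_ascents (a : ℕ) (t : List ℕ) :
    descents (a :: t) + plateaus (a :: t) + descents (a :: t).reverse = t.length + 2 := by
  induction t generalizing a with
  | nil => simp [descents, plateaus]
  | cons b t ih =>
    have := ih b
    simp only [List.reverse_cons, List.append_assoc, List.cons_append, List.nil_append,
      descents_append_pair, descents, plateaus, List.length_cons] at this ⊢
    rcases lt_trichotomy a b with h | h | h
    · simp [h, h.ne, h.asymm]; omega
    · simp [h]; omega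
    · simp [h, h.ne', h.asymm]; omega

/-- Whatever the gap was, after the insertion of `m m` it contributes an ascent, a plateau and one
descent. So the count is kept exactly at the descents, the end included. The fixed first letter `a`
leaves only gaps that have a letter on their left. -/
theorem descents_cons_insert {m a : ℕ} {w : List ℕ} (h : ∀ x ∈ a :: w, x < m) :
    (∀ i, descents (a :: (w.take i ++ m :: m :: w.drop i)) = descents (a :: w) ∨
        descents (a :: (w.take i ++ m :: m :: w.drop i)) = descents (a :: w) + 1) ∧
      ∑ i ∈ Finset.range (w.length + 1),
        (if descents (a :: (w.take i ++ m :: m :: w.drop i)) = descents (a :: w) then 1 else 0)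
          = descents (a :: w) := by
  have ha := h a (by simp)
  induction w generalizing a with
  | nil => simp [descents, ha.le]
  | cons b w ih =>
    have hb := h b (by simp)
    obtain ⟨h1, h2⟩ := ih (a := b) (fun x hx => h x (by simp [hx])) hb
    have h0 : descents (a :: m :: m :: b :: w) = 1 + descents (b :: w) := by
      simp [descents, hb, ha.le]
    constructor
    · rintro (_ | i)
      · simp only [List.take_zero, List.drop_zero, List.nil_append, h0]
        rw [descents]
        split_ifs <;> omega
      · simpa [descents, add_assoc] using h1 i
    · rw [List.length_cons, Finset.sum_range_succ']
      simp only [List.take_succ_cons, List.drop_succ_cons, List.cons_append, List.take_zero,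
        List.drop_zero, List.nil_append, h0]
      simp only [descents, add_right_inj]
      rw [h2, add_comm]
      congr 1
      split_ifs <;> first | rfl | omega

theorem descents_insert {m : ℕ} {w : List ℕ} (h : ∀ x ∈ w, x < m) :
    (∀ i, descents (w.take i ++ m :: m :: w.drop i) = descents w ∨
        descents (w.take i ++ m :: m :: w.drop i) = descents w + 1) ∧
      ∑ i ∈ Finset.range (w.length + 1),
        (if descents (w.take i ++ m :: m :: w.drop i) = descents w then 1 else 0)
          = descents w := by
  cases w with
  | nil => simp [descents]
  | cons a w =>
    obtain ⟨h1, h2⟩ := descents_cons_insert h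
    have h0 : descents (m :: m :: a :: w) = descents (a :: w) + 1 := by
      simp [descents, h a (by simp), add_comm]
    constructor
    · rintro (_ | i)
      · exact .inr h0
      · exact h1 i
    · rw [List.length_cons, Finset.sum_range_succ']
      refine (congrArg₂ (· + ·) h2 ?_).trans (add_zero _)
      simp [h0]

/-- No letter exceeds `n + 1`, so its two copies are adjacent, and deleting them inverts the
insertion. -/
theorem bijOn_insertPair (n : ℕ) :
    Set.BijOn (fun p : List ℕ × ℕ => p.1.take p.2 ++ (n + 1) :: (n + 1) :: p.1.drop p.2)
      ({w | IsStirlingPerm (Finset.Icc 1 n) w} ×ˢ Set.Iio (2 * n + 1))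
      {w | IsStirlingPerm (Finset.Icc 1 (n + 1)) w} := by
  have hnm : ∀ {u v : List ℕ}, IsStirlingPerm (Finset.Icc 1 n) (u ++ v) →
      n + 1 ∉ u ∧ n + 1 ∉ v := by
    intro u v h
    have := List.count_eq_zero.1 ((h.1 (n + 1)).trans (if_neg (by simp)))
    simpa using this
  have hcount : ∀ (u v : List ℕ) (a : ℕ), (u ++ (n + 1) :: (n + 1) :: v).count a
      = (u ++ v).count a + if a = n + 1 then 2 else 0 := by
    intro u v a
    simp only [List.count_append, List.count_cons, beq_iff_eq, eq_comm (a := a)]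
    split_ifs <;> omega
  refine bijOn_gapInsertion (fun u v => u ++ (n + 1) :: (n + 1) :: v) ?_ ?_ ?_ ?_
  · intro w hw
    have := hw.length_eq
    simp at this
    omega
  · intro u v h
    obtain ⟨hu, hv⟩ := hnm h
    refine ⟨fun a => ?_, fun a b hab => ?_⟩
    · rw [hcount, h.1]
      simp only [Finset.mem_Icc]
      split_ifs <;> omega
    · by_cases ha : a = n + 1
      · subst ha
        exfalso
        rw [show u ++ (n + 1) :: (n + 1) :: v = u ++ ([n + 1, n + 1] ++ v) by simp] at hab
        rcases sublist_aba_append hab (fun h => absurd h hu) with h1 | h1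
        · exact hu (h1.subset (by simp))
        · rcases sublist_aba_append h1 (fun _ => hv) with h1 | h1
          · simpa using h1.length_le
          · exact hv (h1.subset (by simp))
      · by_cases hb : b = n + 1
        · have hmem : a ∈ u ++ v := by
            have := hab.subset (show a ∈ [a, b, a] by simp)
            simpa [ha] using this
          have := ((isStirlingPerm_iff.1 h).2 a).1 hmem
          simp only [Finset.mem_Icc] at this
          omega
        · have h1 := hab.filter (fun x => decide (x ≠ n + 1))
          have h2 : ∀ {l : List ℕ}, n + 1 ∉ l → l.filter (fun x => decide (x ≠ n + 1)) = l := by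
            intro l hl
            rw [List.filter_eq_self]
            intro x hx
            simpa using ne_of_mem_of_not_mem hx hl
          rw [List.filter_append, h2 hu] at h1
          have h3 : ((n + 1) :: (n + 1) :: v).filter (fun x => decide (x ≠ n + 1)) = v := by
            rw [List.filter_cons_of_neg (by simp), List.filter_cons_of_neg (by simp), h2 hv]
          rw [h3] at h1
          refine h.2 a b ?_
          simpa [ha, hb] using h1
  · intro u v u' v' h h' he
    -- Regrouped so that the split is at the last copy of `n + 1`.
    have he' : (u ++ [n + 1]) ++ (n + 1) :: v = (u' ++ [n + 1]) ++ (n + 1) :: v' := by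
      simpa using he
    obtain ⟨h1, h2⟩ := append_cons_inj_of_notMem_right (hnm h).2 (hnm h').2 he'
    exact ⟨List.append_cancel_right h1, h2⟩
  · intro w hw
    obtain ⟨hw', hm⟩ := isStirlingPerm_iff.1 hw
    obtain ⟨A, B, C, rfl, -, -, -, hB, -⟩ :=
      hw'.exists_split ((hm (n + 1)).2 (by simp))
    obtain rfl : B = [] := by
      rw [List.eq_nil_iff_forall_not_mem]
      intro x hx
      have h1 := hB x hx
      have h2 := (hm x).1 (by simp [hx])
      simp only [Finset.mem_Icc] at h2
      omega
    refine ⟨A, C, ⟨fun a => ?_, fun a b hab => hw.2 a b (hab.trans ?_)⟩, rfl⟩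
    · have h1 := hw.1 a
      rw [List.nil_append, hcount] at h1
      simp only [Finset.mem_Icc] at h1 ⊢
      split_ifs at h1 ⊢ <;> omega
    · exact (List.Sublist.refl A).append
        ((List.sublist_cons_self _ _).trans (List.sublist_cons_self _ _))

theorem encard_stirlingPerm_descents (n : ℕ) :
    {w | IsStirlingPerm (Finset.Icc 1 n) w}.Finite ∧
      ∀ k, {w | w ∈ {w | IsStirlingPerm (Finset.Icc 1 n) w} ∧ descents w = k}.encard
        = (eulerianTwo n k : ℕ∞) := by
  induction n with
  | zero =>
    have h0 : {w | IsStirlingPerm (Finset.Icc 1 0) w} = {[]} := by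
      ext w
      simp only [Set.mem_ofPred_eq, Set.mem_singleton_iff]
      constructor
      · intro hw
        exact List.length_eq_zero_iff.1 hw.length_eq
      · rintro rfl
        exact isStirlingPerm_iff.2 ⟨isStirlingWord_nil, by simp⟩
    rw [h0]
    refine ⟨Set.finite_singleton _, fun k => ?_⟩
    cases k with
    | zero =>
      rw [Set.encard_eq_one.2 ⟨[], ?_⟩]
      · simp [eulerianTwo]
      · ext p
        simp only [Set.mem_singleton_iff, Set.mem_ofPred_eq, and_iff_left_iff_imp]
        rintro rfl
        rfl
    | succ k =>
      simp only [eulerianTwo, Nat.cast_zero, Set.encard_eq_zero]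
      ext p
      simp only [Set.mem_singleton_iff, Set.mem_ofPred_eq, Set.mem_empty_iff_false, iff_false,
        not_and]
      rintro rfl
      simp [descents]
  | succ n ih =>
    have hlt : ∀ w ∈ {w | IsStirlingPerm (Finset.Icc 1 n) w}, ∀ x ∈ w, x < n + 1 := by
      intro w hw x hx
      have := ((isStirlingPerm_iff.1 hw).2 x).1 hx
      simp only [Finset.mem_Icc] at this
      omega
    have hlen : ∀ w ∈ {w | IsStirlingPerm (Finset.Icc 1 n) w}, 2 * n + 1 = w.length + 1 := by
      intro w hw
      have := IsStirlingPerm.length_eq hw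
      simp at this
      omega
    refine encard_eq_eulerianTwo_succ
      (fun w i => w.take i ++ (n + 1) :: (n + 1) :: w.drop i) _ _
      (bijOn_insertPair n) ?_ ?_ ih.1 ih.2
    · intro w hw i _
      exact (descents_insert (hlt w hw)).1 i
    · intro w hw
      rw [hlen w hw]
      exact (descents_insert (hlt w hw)).2

/-! ### The involution -/

theorem minEntry_eq {m a : ℕ} {l : List ℕ} (hm : m ∈ a :: l) (h : ∀ x ∈ a :: l, m ≤ x) :
    minEntry a l = m :=
  le_antisymm (minEntry_le m hm) (h _ (minEntry_mem a l))

theorem before_append_cons {m : ℕ} {A : List ℕ} (hA : m ∉ A) (X : List ℕ) :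
    before m (A ++ m :: X) = A := by
  induction A with
  | nil => simp [before]
  | cons a A ih =>
    have : a ≠ m := by rintro rfl; simp at hA
    have h2 := ih fun h => hA (by simp [h])
    simp only [before] at h2 ⊢
    simp [this, h2]

theorem after_append_cons {m : ℕ} {A : List ℕ} (hA : m ∉ A) (X : List ℕ) :
    after m (A ++ m :: X) = X := by
  induction A with
  | nil => simp [after]
  | cons a A ih =>
    have : a ≠ m := by rintro rfl; simp at hA
    have h2 := ih fun h => hA (by simp [h])
    simp only [after] at h2 ⊢
    simp [this, h2]

theorem swapInvolution_node {m : ℕ} {A B C : List ℕ} (hA : m ∉ A) (hB : m ∉ B)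
    (hle : ∀ x ∈ A ++ m :: (B ++ m :: C), m ≤ x) :
    swapInvolution (A ++ m :: (B ++ m :: C)) =
      swapInvolution A ++ m :: (swapInvolution C ++ m :: swapInvolution B) := by
  obtain ⟨a, l, h⟩ : ∃ a l, A ++ m :: (B ++ m :: C) = a :: l :=
    List.exists_cons_of_ne_nil (by simp)
  have hm : minEntry a l = m := minEntry_eq (by simp [← h]) (by rwa [← h])
  rw [h, swapInvolution, hm, ← h, before_append_cons hA, after_append_cons hA,
    before_append_cons hB, after_append_cons hB]

/-- Here the correction depends on `C`, for plateaus on `B`; this asymmetry is what exchanging the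
two blocks exploits. -/
theorem descents_node {m : ℕ} {A B C : List ℕ} (hA : ∀ x ∈ A, m < x) (hB : ∀ x ∈ B, m < x)
    (hC : ∀ x ∈ C, m < x) : descents (A ++ m :: (B ++ m :: C)) =
      descents A + descents B + descents C + if C = [] then 1 else 0 := by
  rw [descents_append_cons hA, descents_wrap hB, descents_cons_of_lt hC]
  ring

theorem plateaus_node {m : ℕ} {A B C : List ℕ} (hA : m ∉ A) (hB : m ∉ B)
    (hC : m ∉ C) : plateaus (A ++ m :: (B ++ m :: C)) =
      plateaus A + plateaus B + plateaus C + if B = [] then 1 else 0 := by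
  rw [plateaus_append_cons hA, plateaus_wrap hB hC]
  ring

/-- All claims go through one induction, since preservation of the letters is needed for the others:
it keeps `m` smallest, so that the recursion applies again, and makes the image of a block empty
exactly if the block is. -/
theorem IsStirlingWord.swapInvolution_spec {w : List ℕ} (hw : IsStirlingWord w) :
    (∀ x, x ∈ swapInvolution w ↔ x ∈ w) ∧ IsStirlingWord (swapInvolution w) ∧
      swapInvolution (swapInvolution w) = w ∧ descents (swapInvolution w) = plateaus w ∧
      plateaus (swapInvolution w) = descents w := by
  refine hw.induction (P := fun w => (∀ x, x ∈ swapInvolution w ↔ x ∈ w) ∧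
      IsStirlingWord (swapInvolution w) ∧ swapInvolution (swapInvolution w) = w ∧
      descents (swapInvolution w) = plateaus w ∧ plateaus (swapInvolution w) = descents w) ?_ ?_
  · simp [swapInvolution, isStirlingWord_nil, descents, plateaus]
  · rintro m A B C hA hB hC hAB hAC hBC ⟨mA, sA, iA, dA, pA⟩ ⟨mB, sB, iB, dB, pB⟩
      ⟨mC, sC, iC, dC, pC⟩
    have notMem : ∀ {X : List ℕ}, (∀ x ∈ X, m < x) → m ∉ X := fun h hm => lt_irrefl _ (h m hm)
    have hA' : ∀ x ∈ swapInvolution A, m < x := fun x hx => hA x ((mA x).1 hx)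
    have hB' : ∀ x ∈ swapInvolution B, m < x := fun x hx => hB x ((mB x).1 hx)
    have hC' : ∀ x ∈ swapInvolution C, m < x := fun x hx => hC x ((mC x).1 hx)
    have hnilB : swapInvolution B = [] ↔ B = [] := by
      simp only [List.eq_nil_iff_forall_not_mem, mB]
    have hnilC : swapInvolution C = [] ↔ C = [] := by
      simp only [List.eq_nil_iff_forall_not_mem, mC]
    have hle : ∀ {A B C : List ℕ}, (∀ x ∈ A, m < x) → (∀ x ∈ B, m < x) → (∀ x ∈ C, m < x) →
        ∀ x ∈ A ++ m :: (B ++ m :: C), m ≤ x := by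
      intro A B C hA hB hC x hx
      simp only [List.mem_append, List.mem_cons] at hx
      rcases hx with h | rfl | h | rfl | h
      exacts [(hA x h).le, le_rfl, (hB x h).le, le_rfl, (hC x h).le]
    rw [swapInvolution_node (notMem hA) (notMem hB) (hle hA hB hC)]
    refine ⟨fun x => ?_, ?_, ?_, ?_, ?_⟩
    · simp only [List.mem_append, List.mem_cons, mA, mB, mC]
      tauto
    · rw [isStirlingWord_node (notMem hA') (notMem hB') hC']
      · exact ⟨sA, sC, sB⟩
      · simpa only [mA, mC] using hAC
      · simpa only [mA, mB] using hAB
      · simp only [mC, mB]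
        exact fun x h h' => hBC x h' h
    · rw [swapInvolution_node (notMem hA') (notMem hC') (hle hA' hC' hB'), iA, iB, iC]
    · rw [descents_node hA' hC' hB', plateaus_node (notMem hA) (notMem hB) (notMem hC), dA, dB, dC]
      simp only [hnilB]
      ring
    · rw [plateaus_node (notMem hA') (notMem hC') (notMem hB'), descents_node hA hB hC, pA, pB, pC]
      simp only [hnilC]
      ring

theorem IsStirlingPerm.swapInvolution {S : Finset ℕ} {w : List ℕ} (h : IsStirlingPerm S w) :
    IsStirlingPerm S (swapInvolution w) := by
  obtain ⟨h1, h2⟩ := isStirlingPerm_iff.1 h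
  have := h1.swapInvolution_spec
  exact isStirlingPerm_iff.2 ⟨this.2.1, fun a => (this.1 a).trans (h2 a)⟩

theorem encard_stirlingPerm_plateaus (n k : ℕ) :
    {w | w ∈ {w | IsStirlingPerm (Finset.Icc 1 n) w} ∧ plateaus w = k}.encard
      = (eulerianTwo n k : ℕ∞) := by
  rw [← (encard_stirlingPerm_descents n).2 k]
  have hspec : ∀ w ∈ {w | IsStirlingPerm (Finset.Icc 1 n) w}, _ := fun w hw =>
    (isStirlingPerm_iff.1 hw).1.swapInvolution_spec
  refine encard_eq_of_bijOn (f := swapInvolution) ⟨?_, ?_, ?_⟩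
    (fun w hw => (hspec w hw).2.2.2.1) k
  · exact fun w hw => IsStirlingPerm.swapInvolution hw
  · intro w hw w' hw' h
    rw [← (hspec w hw).2.2.1, h, (hspec w' hw').2.2.1]
  · exact fun w hw => ⟨_, IsStirlingPerm.swapInvolution hw, (hspec w hw).2.2.1⟩

theorem encard_stirlingPerm_ascents (n k : ℕ) :
    {w | w ∈ {w | IsStirlingPerm (Finset.Icc 1 n) w} ∧ descents w.reverse = k}.encard
      = (eulerianTwo n k : ℕ∞) := by
  rw [← (encard_stirlingPerm_descents n).2 k]
  refine encard_eq_of_bijOn (f := List.reverse) ⟨?_, ?_, ?_⟩ (fun w _ => rfl) k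
  · exact fun w hw => IsStirlingPerm.reverse hw
  · exact List.reverse_injective.injOn
  · exact fun w hw => ⟨_, IsStirlingPerm.reverse hw, List.reverse_reverse w⟩

/-! ### Increasing ordered trees -/

namespace LabeledForest

/-- The word recording the label of a vertex when it is entered and when it is left in a
depth-first traversal. -/
def word : LabeledForest → List ℕ
  | nil => []
  | cons a c r => a :: (c.word ++ a :: r.word)

theorem mem_word {x : ℕ} {F : LabeledForest} : x ∈ F.word ↔ x ∈ F.labels := by
  induction F with
  | nil => simp [word, labels]
  | cons a c r ihc ihr =>
    simp only [word, labels, List.mem_cons, List.mem_append, ihc, ihr]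
    tauto

theorem word_eq_nil {F : LabeledForest} : F.word = [] ↔ F = nil := by
  cases F <;> simp [word]

theorem IncreasingAbove.lt {p x : ℕ} {F : LabeledForest} (h : IncreasingAbove p F)
    (hx : x ∈ F.labels) : p < x := by
  induction F generalizing p with
  | nil => simp [labels] at hx
  | cons a c r ihc ihr =>
    simp only [labels, List.mem_cons, List.mem_append] at hx
    rcases hx with rfl | hx | hx
    · exact h.1
    · exact h.1.trans (ihc h.2.1 hx)
    · exact ihr h.2.2 hx

theorem nodup_labels_cons {a : ℕ} {c r : LabeledForest} : (cons a c r).labels.Nodup ↔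
    a ∉ c.labels ∧ a ∉ r.labels ∧ c.labels.Nodup ∧ r.labels.Nodup ∧
      ∀ x ∈ c.labels, x ∉ r.labels := by
  simp only [labels, List.nodup_cons, List.mem_append, not_or, List.nodup_append', List.Disjoint]
  tauto

theorem isStirlingWord_word {p : ℕ} {F : LabeledForest} (h : IncreasingAbove p F)
    (hd : F.labels.Nodup) : IsStirlingWord F.word := by
  induction F generalizing p with
  | nil => exact isStirlingWord_nil
  | cons a c r ihc ihr =>
    obtain ⟨h1, h2, h3, h4, h5⟩ := nodup_labels_cons.1 hd
    refine (isStirlingWord_node (A := []) (by simp) (by rwa [mem_word]) ?_ (by simp) (by simp)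
      ?_).2 ⟨isStirlingWord_nil, ihc h.2.1 h3, ihr h.2.2 h4⟩
    · exact fun x hx => h.2.1.lt (mem_word.1 hx)
    · simpa only [mem_word] using h5

/-- The first letter is the label of the first root, and its next occurrence ends the word of the
children, which consists of larger labels. -/
theorem word_inj {p p' : ℕ} {F F' : LabeledForest} (h : IncreasingAbove p F)
    (h' : IncreasingAbove p' F') (hw : F.word = F'.word) : F = F' := by
  induction F generalizing p p' F' with
  | nil => exact (word_eq_nil.1 hw.symm).symm
  | cons a c r ihc ihr =>
    cases F' with
    | nil => simp [word] at hw
    | cons a' c' r' =>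
      simp only [word, List.cons.injEq] at hw
      obtain ⟨rfl, hw⟩ := hw
      have hc : a ∉ c.word := fun hm => lt_irrefl _ (h.2.1.lt (mem_word.1 hm))
      have hc' : a ∉ c'.word := fun hm => lt_irrefl _ (h'.2.1.lt (mem_word.1 hm))
      have e1 := congrArg (before a) hw
      have e2 := congrArg (after a) hw
      rw [before_append_cons hc, before_append_cons hc'] at e1
      rw [after_append_cons hc, after_append_cons hc'] at e2
      rw [ihc h.2.1 h'.2.1 e1, ihr h.2.2 h'.2.2 e2]

theorem exists_word_eq {p : ℕ} {w : List ℕ} (hw : IsStirlingWord w) (hp : ∀ x ∈ w, p < x) :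
    ∃ F : LabeledForest, F.word = w ∧ IncreasingAbove p F ∧ F.labels.Nodup := by
  induction hn : w.length using Nat.strong_induction_on generalizing w p with
  | _ n ih =>
    subst hn
    rcases w with _ | ⟨a, l⟩
    · exact ⟨nil, rfl, trivial, by simp [labels]⟩
    obtain ⟨A, B, C, h, hA, hB, hC, hmB, hAB, hBC, hAC⟩ :=
      hw.exists_split (List.mem_cons_self (a := a) (l := l))
    obtain rfl : A = [] := by
      cases A with
      | nil => rfl
      | cons x A =>
        simp only [List.cons_append, List.cons.injEq] at h
        simp [h.1] at hA
    rw [h] at hw hp ih ⊢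
    rw [isStirlingWord_node hA hC hmB hAB (by simp) hBC] at hw
    simp only [List.nil_append, List.length_append, List.length_cons] at ih
    obtain ⟨c, rfl, hc, hcd⟩ := ih B.length (by omega) hw.2.1 hmB rfl
    obtain ⟨r, rfl, hr, hrd⟩ := ih C.length (by omega) hw.2.2 (p := p)
      (fun x hx => hp x (by simp [hx])) rfl
    refine ⟨cons a c r, rfl, ⟨hp a (by simp), hc, hr⟩, nodup_labels_cons.2 ?_⟩
    simp only [mem_word] at hB hC hBC
    exact ⟨hB, hC, hcd, hrd, hBC⟩

theorem leaves_cons (a : ℕ) (c r : LabeledForest) :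
    (cons a c r).leaves = c.leaves + r.leaves + if c.word = [] then 1 else 0 := by
  cases c with
  | nil => simp [leaves, word, add_comm]
  | cons => simp [leaves, word]

/-- A plateau is a vertex left immediately after being entered. -/
theorem plateaus_word {p : ℕ} {F : LabeledForest} (h : IncreasingAbove p F)
    (hd : F.labels.Nodup) : plateaus F.word = F.leaves := by
  induction F generalizing p with
  | nil => rfl
  | cons a c r ihc ihr =>
    obtain ⟨h1, h2, h3, h4, h5⟩ := nodup_labels_cons.1 hd
    rw [word, plateaus_wrap (by rwa [mem_word]) (by rwa [mem_word]), ihc h.2.1 h3, ihr h.2.2 h4,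
      leaves_cons]

/-- The last exit in each nonempty sibling list is followed by the smaller parent or by the end of
the word, so it is a descent; the other descents are the sibling descents. There is one such list
for each non-leaf, and one for the roots. -/
theorem descents_word_add_leaves {p : ℕ} {F : LabeledForest} (h : IncreasingAbove p F) :
    descents F.word + F.leaves
      = F.siblingDescents + F.labels.length + if F.word = [] then 0 else 1 := by
  induction F generalizing p with
  | nil => rfl
  | cons a c r ihc ihr =>
    have ec := ihc h.2.1
    have er := ihr h.2.2
    rw [word, descents_wrap fun x hx => h.2.1.lt (mem_word.1 hx), leaves_cons]
    have hr : descents (a :: r.word) + c.siblingDescents + r.siblingDescents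
        = (cons a c r).siblingDescents + descents r.word + if r.word = [] then 1 else 0 := by
      cases r with
      | nil => simp [word, descents, siblingDescents, firstLabel, add_comm]
      | cons b =>
        simp only [word, descents, siblingDescents, firstLabel, reduceCtorEq, if_false]
        omega
    rw [labels, List.length_cons, List.length_append]
    simp only [reduceCtorEq, if_false]
    split_ifs at ec er hr ⊢ <;> omega

end LabeledForest

open LabeledForest

theorem LabeledTree.isIncreasingOrdered_iff {n : ℕ} {T : LabeledTree} :
    T.IsIncreasingOrdered n ↔ T.rootLabel = 0 ∧ IncreasingAbove 0 T.branches ∧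
      T.branches.labels.Nodup ∧ ∀ x, x ∈ T.branches.labels ↔ x ∈ Finset.Icc 1 n := by
  obtain ⟨a, F⟩ := T
  constructor
  · rintro ⟨h1, h2⟩
    simp only [LabeledTree.labels] at h1 h2 ⊢
    have hd := h1.nodup_iff.2 List.nodup_range
    rw [List.nodup_cons] at hd
    -- The label `0` occurs, and below the root it would have to exceed the root label.
    obtain rfl : a = 0 := by
      have h0 := h1.mem_iff.2 (List.mem_range.2 n.succ_pos)
      rcases List.mem_cons.1 h0 with h | h
      · exact h.symm
      · exact absurd (h2.lt h) (Nat.not_lt_zero _)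
    refine ⟨rfl, h2, hd.2, fun x => ?_⟩
    have hx := h1.mem_iff (a := x)
    rw [List.mem_cons, List.mem_range] at hx
    rw [Finset.mem_Icc]
    constructor
    · intro h
      have := h2.lt h
      have := hx.1 (.inr h)
      omega
    · intro h
      exact (hx.2 (by omega)).resolve_left (by omega)
  · rintro ⟨rfl, h2, hd, hm⟩
    refine ⟨(List.perm_ext_iff_of_nodup ?_ List.nodup_range).2 fun x => ?_, h2⟩
    · exact List.nodup_cons.2 ⟨fun h => lt_irrefl _ (h2.lt h), hd⟩
    · simp only [LabeledTree.labels, List.mem_cons, List.mem_range] at hm ⊢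
      rw [hm, Finset.mem_Icc]
      omega

theorem bijOn_word (n : ℕ) :
    Set.BijOn (fun T : LabeledTree => T.branches.word) {T | T.IsIncreasingOrdered n}
      {w | IsStirlingPerm (Finset.Icc 1 n) w} := by
  refine ⟨?_, ?_, ?_⟩
  · intro T hT
    obtain ⟨-, h1, h2, h3⟩ := LabeledTree.isIncreasingOrdered_iff.1 hT
    exact isStirlingPerm_iff.2 ⟨isStirlingWord_word h1 h2, fun a => mem_word.trans (h3 a)⟩
  · rintro ⟨a, F⟩ hT ⟨a', F'⟩ hT' h
    obtain ⟨h0, h1, -⟩ := LabeledTree.isIncreasingOrdered_iff.1 hT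
    obtain ⟨h0', h1', -⟩ := LabeledTree.isIncreasingOrdered_iff.1 hT'
    have := word_inj h1 h1' h
    simp_all
  · intro w hw
    obtain ⟨h1, h2⟩ := isStirlingPerm_iff.1 hw
    obtain ⟨F, rfl, h3, h4⟩ := exists_word_eq (p := 0) h1 fun x hx => by
      have := (h2 x).1 hx
      simp only [Finset.mem_Icc] at this
      omega
    exact ⟨⟨0, F⟩, LabeledTree.isIncreasingOrdered_iff.2
      ⟨rfl, h3, h4, fun x => mem_word.symm.trans (h2 x)⟩, rfl⟩

/-- The root itself is a leaf only in the one-vertex tree. -/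
theorem LabeledTree.IsIncreasingOrdered.leaves_eq {n : ℕ} (hn : 1 ≤ n) {T : LabeledTree}
    (hT : T.IsIncreasingOrdered n) : T.leaves = T.branches.leaves := by
  obtain ⟨a, F⟩ := T
  cases F with
  | nil =>
    have := hT.1.length_eq
    simp [LabeledTree.labels, LabeledForest.labels] at this
    omega
  | cons => rfl

theorem encard_tree_leaves {n : ℕ} (hn : 1 ≤ n) (k : ℕ) :
    {T | T ∈ {T : LabeledTree | T.IsIncreasingOrdered n} ∧ T.leaves = k}.encard
      = (eulerianTwo n k : ℕ∞) := by
  rw [← encard_stirlingPerm_plateaus]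
  refine encard_eq_of_bijOn (bijOn_word n) (fun T hT => ?_) k
  obtain ⟨-, h1, h2, -⟩ := LabeledTree.isIncreasingOrdered_iff.1 hT
  rw [hT.leaves_eq hn, plateaus_word h1 h2]

/-- Descents, plateaus and ascents of the word total `2n + 1`, while descents and plateaus together
exceed the sibling descents by `n + 1`. -/
theorem LabeledTree.IsIncreasingOrdered.ascents_add_siblingDescents {n : ℕ} (hn : 1 ≤ n)
    {T : LabeledTree} (hT : T.IsIncreasingOrdered n) :
    descents T.branches.word.reverse + T.siblingDescents = n := by
  obtain ⟨-, h1, h2, -⟩ := LabeledTree.isIncreasingOrdered_iff.1 hT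
  have e1 := plateaus_word h1 h2
  have e2 := descents_word_add_leaves h1
  have e3 := hT.1.length_eq
  have e4 := ((bijOn_word n).mapsTo hT).length_eq
  simp only [LabeledTree.labels, List.length_cons, List.length_range] at e3
  simp only [Nat.card_Icc] at e4
  rw [LabeledTree.siblingDescents]
  rcases h : T.branches.word with _ | ⟨a, t⟩
  · rw [h] at e4
    simp at e4
    omega
  · have e5 := descents_add_plateaus_add_ascents a t
    rw [h] at e1 e2 e4
    simp only [List.length_cons, reduceCtorEq, if_false] at e2 e4
    omega

theorem encard_tree_siblingDescents {n : ℕ} (hn : 1 ≤ n) (k : ℕ) :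
    {T | T ∈ {T : LabeledTree | T.IsIncreasingOrdered n} ∧ T.siblingDescents = k}.encard
      = (eulerianTwo n (n - k) : ℕ∞) := by
  refine encard_complement_statistic (s := fun T => descents T.branches.word.reverse)
    (e := eulerianTwo n) (eulerianTwo_zero_right hn)
    (fun T hT => hT.ascents_add_siblingDescents hn) (fun k => ?_) k
  rw [← encard_stirlingPerm_ascents]
  exact encard_eq_of_bijOn (t := fun w => descents w.reverse) (bijOn_word n) (fun T _ => rfl) k

theorem encard_hlDyckPath_peaks {n : ℕ} (hn : 1 ≤ n) (k : ℕ) :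
    {p | p ∈ {p | IsHLDyckPath n p} ∧ peaks p = k}.encard
      = (eulerianTwo n (n + 1 - k) : ℕ∞) := by
  refine encard_complement_statistic (s := upstepFreeVertices)
    (e := eulerianTwo n) (eulerianTwo_zero_right hn) ?_ (encard_hlDyckPath hn) k
  rintro p ⟨hp, rfl⟩
  have := (peaks_add_upstepFreeAux hp).1
  rw [upstepFreeVertices]
  omega

end StirlingObjects

/-! ### The main theorem -/

theorem mainTheorem4 :
    (∀ n : ℕ, 1 ≤ n →
      -- the identity
      (∑ k ∈ Finset.Icc 1 n, eulerianTwo n k = Nat.doubleFactorial (2 * n - 1)) ∧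
      -- Stirling permutations by descents
      (∀ k : ℕ, {w : List ℕ | IsStirlingPerm (Finset.Icc 1 n) w ∧ descents w = k}.encard
        = (eulerianTwo n k : ℕ∞)) ∧
      -- Stirling permutations by plateaus
      (∀ k : ℕ, {w : List ℕ | IsStirlingPerm (Finset.Icc 1 n) w ∧ plateaus w = k}.encard
        = (eulerianTwo n k : ℕ∞)) ∧
      -- increasing ordered trees by leaves
      (∀ k : ℕ, {T : LabeledTree | T.IsIncreasingOrdered n ∧ T.leaves = k}.encard
        = (eulerianTwo n k : ℕ∞)) ∧
      -- height-labeled Dyck paths by upstep-free vertices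
      (∀ k : ℕ, {p : List HLStep | IsHLDyckPath n p ∧ upstepFreeVertices p = k}.encard
        = (eulerianTwo n k : ℕ∞)) ∧
      -- trapezoidal words by distinct entries
      (∀ k : ℕ, {w : Fin n → ℕ | IsTrapezoidal w ∧ distinctEntries w = k}.encard
        = (eulerianTwo n k : ℕ∞)) ∧
      -- increasing ordered trees by sibling descents (both sides vanish for `k ≥ n`)
      (∀ k : ℕ, {T : LabeledTree | T.IsIncreasingOrdered n ∧ T.siblingDescents = k}.encard
        = (eulerianTwo n (n - k) : ℕ∞)) ∧
      -- height-labeled Dyck paths by peaks (both sides vanish for `k = 0` and for `k > n`)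
      (∀ k : ℕ, {p : List HLStep | IsHLDyckPath n p ∧ peaks p = k}.encard
        = (eulerianTwo n (n + 1 - k) : ℕ∞))) ∧
    -- the explicit involution that interchanges descents and plateaus
    (swapInvolution [] = []) ∧
    (∀ (S : Finset ℕ) (A B C : List ℕ) (m : ℕ), IsStirlingPerm S (A ++ m :: (B ++ m :: C)) →
      (∀ x ∈ S, m ≤ x) →
      swapInvolution (A ++ m :: (B ++ m :: C)) =
        swapInvolution A ++ m :: (swapInvolution C ++ m :: swapInvolution B)) ∧
    (∀ (S : Finset ℕ) (w : List ℕ), IsStirlingPerm S w →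
      IsStirlingPerm S (swapInvolution w) ∧
      swapInvolution (swapInvolution w) = w ∧
      descents (swapInvolution w) = plateaus w ∧
      plateaus (swapInvolution w) = descents w) := by
  refine ⟨fun n hn => ⟨sum_eulerianTwo hn, (encard_stirlingPerm_descents n).2,
    encard_stirlingPerm_plateaus n, encard_tree_leaves hn, encard_hlDyckPath hn,
    (encard_trapezoidal n).2, encard_tree_siblingDescents hn, encard_hlDyckPath_peaks hn⟩,
    by rw [swapInvolution], ?_, ?_⟩
  · intro S A B C m h hS
    have hm := (isStirlingPerm_iff.1 h).2
    have hc := h.1 m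
    -- The two displayed copies of `m` exhaust its multiplicity, so `A` and `B` avoid `m`.
    rw [if_pos ((hm m).1 (by simp))] at hc
    simp only [List.count_append, List.count_cons_self] at hc
    exact swapInvolution_node (List.count_eq_zero.1 (by omega)) (List.count_eq_zero.1 (by omega))
      fun x hx => hS x ((hm x).1 hx)
  · intro S w h
    obtain ⟨-, -, h1, h2, h3⟩ := (isStirlingPerm_iff.1 h).1.swapInvolution_spec
    exact ⟨h.swapInvolution, h1, h2, h3⟩
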